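/- Let $K$ be a field, let $R = K\langle x,y\rangle/(xy-1)$ be the Toeplitz–Jacobson algebra, and let $S = R(1-yx)$ (a simple left ideal of $R$). For a left $R$-module $M$ and a cardinal $\alpha$ write $M^{(\alpha)}$ for the direct sum of $\alpha$ copies of $M$. Every projective left $R$-module $P$ is isomorphic to $R^{(\alpha)}\oplus S^{(\beta)}$ for some cardinals $\alpha,\beta$. Moreover, $(\alpha,\beta)$ can be chosen in one of the following forms: (1) $\alpha$ finite, and $\beta=0$ or $\beta\ge\aleph_0$; (2) $\alpha$ infinite, and $\beta=0$ or $\beta>\alpha$; (3) $\alpha=0$ and $\beta$ finite. These pairs completely describe the isomorphism types of projective left $R$-modules: every module $R^{(\alpha)}\oplus S^{(\beta)}$ is projective, for each projective $P$ there is exactly one pair $(\alpha,\beta)$ of one of these forms with $P\cong R^{(\alpha)}\oplus S^{(\beta)}$, and distinct pairs of these forms give non-isomorphic modules. -/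

import Mathlib

universe u v

namespace ToeplitzJacobson

/-- The single defining relation `x * y = 1` on the free associative `K`-algebra on two
generators, where `x` is the generator indexed by `0` and `y` the one indexed by `1`. -/
inductive Rel (K : Type*) [Field K] : FreeAlgebra K (Fin 2) → FreeAlgebra K (Fin 2) → Prop
  | xy : Rel K (FreeAlgebra.ι K 0 * FreeAlgebra.ι K 1) 1

/-- The (algebraic) Toeplitz-Jacobson algebra `R = K⟨x, y⟩ / (x y - 1)`. -/
abbrev Alg (K : Type*) [Field K] : Type _ := RingQuot (Rel K)

/-- The generator `x` of the Toeplitz-Jacobson algebra. -/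
noncomputable def x (K : Type*) [Field K] : Alg K :=
  RingQuot.mkAlgHom K (Rel K) (FreeAlgebra.ι K 0)

/-- The generator `y` of the Toeplitz-Jacobson algebra. -/
noncomputable def y (K : Type*) [Field K] : Alg K :=
  RingQuot.mkAlgHom K (Rel K) (FreeAlgebra.ι K 1)

/-- The left ideal `S = R (1 - y x)`, regarded as a left `R`-module (the faithful simple one). -/
noncomputable abbrev S (K : Type*) [Field K] : Ideal (Alg K) :=
  Ideal.span {1 - y K * x K}

/-- The left `R`-module `R^(α) ⊕ S^(β)`: the direct sum of `α` copies of `R` and `β` copies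
of `S`, for cardinals `α` and `β`. -/
abbrev DirectSumRS (K : Type*) [Field K] (α β : Cardinal.{v}) : Type _ :=
  (Quotient.out α →₀ Alg K) × (Quotient.out β →₀ S K)

/-- The normalized pairs `(α, β)` of cardinals:
* `α` is finite, and `β = 0` or `β ≥ ℵ₀`; or
* `α` is infinite, and `β = 0` or `β > α`; or
* `α = 0` and `β` is finite. -/
def IsNormalized (α β : Cardinal.{v}) : Prop :=
  (α < Cardinal.aleph0 ∧ (β = 0 ∨ Cardinal.aleph0 ≤ β)) ∨
  (Cardinal.aleph0 ≤ α ∧ (β = 0 ∨ α < β)) ∨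
  (α = 0 ∧ β < Cardinal.aleph0)

end ToeplitzJacobson

/-! A projective `P` embeds in a free module. Since `x * y = 1`, every element of `R` becomes a
polynomial in `x` after left multiplication by a power of `x`. The vectors of `P` with polynomial
coordinates form a `K[X]`-submodule of a free module, hence a free one, `K[X]` being a PID. Its
basis stays independent over `R` and spans a free `Q ⊆ P` with `P ⧸ Q` `x`-torsion
(`exists_linearIndependent_x_torsion`). An `x`-torsion module is a sum of copies of `S`, indexed by
a basis of the kernel of `x`; as `S` is projective, `P ≅ Q ⊕ P ⧸ Q`.

The normal forms come from `R ≅ R ⊕ S` (`nonempty_finsupp_equiv_prod`), by which copies of `R`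
absorb copies of `S`. For uniqueness, the augmentation `x, y ↦ 1` kills `S` and recovers `α`
(`mk_eq_of_equiv`); the kernel of `x` has dimension `α * ℵ₀ + β`; finite generation separates `β =
0` from `β = ℵ₀` when `α` is finite and nonzero. -/

/-! ### Submodules of free modules over a PID -/

section FreeOverPID

open Module

/-- A submodule of a free module of arbitrary rank over a principal ideal domain is free. -/
theorem Submodule.free_of_finsupp_of_pid {A : Type*} [CommRing A] [IsDomain A]
    [IsPrincipalIdealRing A] {J : Type*} (N : Submodule A (J →₀ A)) : Module.Free A N := by
  classical
  obtain ⟨hlin, hwf⟩ := exists_wellFoundedLT J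
  -- With `J` well-ordered, `I i` is the ideal of leading coefficients at `i`, and `w i` will
  -- realize its generator. The `w i` with nonzero generator are triangular and form the basis.
  let I : J → Ideal A := fun i =>
    (N ⊓ Finsupp.supported A A (Set.Iic i)).map (Finsupp.lapply i)
  let g : J → A := fun i => Submodule.IsPrincipal.generator (I i)
  have hg : ∀ i, g i ∈ I i := fun i => Submodule.IsPrincipal.generator_mem _
  choose w hw hwg using hg
  replace hwg : ∀ i, w i i = g i := hwg
  have hw0 : ∀ i j, i < j → w i j = 0 := fun i j hij => by
    by_contra h
    exact absurd ((Finsupp.mem_supported _ _).1 (hw i).2 (Finsupp.mem_support_iff.2 h))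
      (not_le.2 hij)
  have hli' : LinearIndependent A fun i : {i // g i ≠ 0} => w i := by
    refine linearIndependent_iff.2 fun c hc => ?_
    by_contra hne
    have hs : c.support.Nonempty := Finsupp.support_nonempty_iff.2 hne
    have hm := c.support.max'_mem hs
    set m := c.support.max' hs with hmdef
    have h1 : (Finsupp.linearCombination A (fun i : {i // g i ≠ 0} => w i) c) m = c m * g m := by
      rw [Finsupp.linearCombination_apply, Finsupp.sum, Finsupp.finsetSum_apply,
        Finset.sum_eq_single m]
      · simp [hwg]
      · intro j hj hjm
        have : j < m := lt_of_le_of_ne (Finset.le_max' _ _ hj) hjm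
        simp [hw0 j m this]
      · exact fun h => absurd hm h
    rw [hc] at h1
    exact mul_ne_zero (Finsupp.mem_support_iff.1 hm) m.2 h1.symm
  let b : {i // g i ≠ 0} → N := fun i => ⟨w i, (hw i).1⟩
  have hli : LinearIndependent A b := LinearIndependent.of_comp N.subtype hli'
  have hsp : ∀ i, ∀ f : N, (f : J →₀ A) ∈ Finsupp.supported A A (Set.Iic i) →
      f ∈ Submodule.span A (Set.range b) := by
    intro i
    induction i using WellFoundedLT.induction with
    | ind i ih =>
    intro f hf
    have hfi : (f : J →₀ A) i ∈ I i := ⟨f, ⟨f.2, hf⟩, rfl⟩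
    obtain ⟨a, ha⟩ := (Submodule.IsPrincipal.mem_iff_eq_smul_generator _).1 hfi
    replace ha : (f : J →₀ A) i = a * g i := ha
    let f' : N := f - a • ⟨w i, (hw i).1⟩
    have hw' : a • (⟨w i, (hw i).1⟩ : N) ∈ Submodule.span A (Set.range b) := by
      -- If `g i = 0`, then `w i` is not a basis vector, but its support lies strictly below `i`, so
      -- induction covers it.
      by_cases h0 : g i = 0
      · by_cases hwi : w i = 0
        · have : (⟨w i, (hw i).1⟩ : N) = 0 := Subtype.ext hwi
          rw [this, smul_zero]; exact zero_mem _
        · have hs := Finsupp.support_nonempty_iff.2 hwi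
          have hm := (w i).support.max'_mem hs
          have hmi : (w i).support.max' hs < i := by
            refine lt_of_le_of_ne ((Finsupp.mem_supported _ _).1 (hw i).2 hm) fun h => ?_
            rw [h] at hm
            exact Finsupp.mem_support_iff.1 hm ((hwg i).trans h0)
          exact Submodule.smul_mem _ _ (ih _ hmi _ ((Finsupp.mem_supported _ _).2
            fun j hj => Finset.le_max' _ _ hj))
      · exact Submodule.smul_mem _ _ (Submodule.subset_span ⟨⟨i, h0⟩, rfl⟩)
    have hf' : f' ∈ Submodule.span A (Set.range b) := by
      by_cases h0 : (f' : J →₀ A) = 0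
      · rw [show f' = 0 from Subtype.ext h0]; exact zero_mem _
      · have hs := Finsupp.support_nonempty_iff.2 h0
        have hm := (f' : J →₀ A).support.max'_mem hs
        have hsub : (f' : J →₀ A) ∈ Finsupp.supported A A (Set.Iic i) :=
          sub_mem hf (Submodule.smul_mem _ a (hw i).2)
        have hmi : (f' : J →₀ A).support.max' hs < i := by
          refine lt_of_le_of_ne ((Finsupp.mem_supported _ _).1 hsub hm) fun h => ?_
          rw [h] at hm
          refine Finsupp.mem_support_iff.1 hm ?_
          simp [f', ha, hwg]
        exact ih _ hmi _ ((Finsupp.mem_supported _ _).2 fun j hj => Finset.le_max' _ _ hj)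
    have : f = f' + a • ⟨w i, (hw i).1⟩ :=
      Subtype.ext (sub_add_cancel (f : J →₀ A) (a • w i)).symm
    rw [this]
    exact add_mem hf' hw'
  refine Module.Free.of_basis (Basis.mk hli fun f _ => ?_)
  by_cases h0 : (f : J →₀ A) = 0
  · rw [show f = 0 from Subtype.ext h0]; exact zero_mem _
  · exact hsp ((f : J →₀ A).support.max' (Finsupp.support_nonempty_iff.2 h0)) f
      ((Finsupp.mem_supported _ _).2 fun j hj => Finset.le_max' _ _ hj)

end FreeOverPID

/-! ### Arithmetic of the algebra -/

namespace ToeplitzJacobson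

open Polynomial

section Algebra

variable {K : Type*} [Field K]

theorem x_mul_y : x K * y K = 1 := by
  rw [x, y, ← map_mul, RingQuot.mkAlgHom_rel K Rel.xy, map_one]

theorem induction {p : Alg K → Prop} (hK : ∀ k, p (algebraMap K (Alg K) k)) (hx : p (x K))
    (hy : p (y K)) (hadd : ∀ r s, p r → p s → p (r + s)) (hmul : ∀ r s, p r → p s → p (r * s))
    (r : Alg K) : p r := by
  obtain ⟨a, rfl⟩ := RingQuot.mkAlgHom_surjective K (Rel K) r
  induction a using FreeAlgebra.induction with
  | grade0 k => rw [AlgHom.commutes]; exact hK k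
  | grade1 i => fin_cases i; exacts [hx, hy]
  | mul a b ha hb => rw [map_mul]; exact hmul _ _ ha hb
  | add a b ha hb => rw [map_add]; exact hadd _ _ ha hb

/-- The algebra homomorphism out of `Alg K` determined by the images of `x` and `y`. -/
noncomputable def lift {B : Type*} [Ring B] [Algebra K B] (a b : B) (h : a * b = 1) :
    Alg K →ₐ[K] B :=
  RingQuot.liftAlgHom K ⟨FreeAlgebra.lift K ![a, b], by rintro _ _ ⟨⟩; simp [h]⟩

theorem lift_x {B : Type*} [Ring B] [Algebra K B] (a b : B) (h : a * b = 1) :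
    lift a b h (x K) = a := by simp [lift, x]

theorem lift_y {B : Type*} [Ring B] [Algebra K B] (a b : B) (h : a * b = 1) :
    lift a b h (y K) = b := by simp [lift, y]

variable (K) in
/-- The idempotent `1 - y x`. -/
noncomputable def e : Alg K := 1 - y K * x K

theorem x_mul_e : x K * e K = 0 := by
  rw [e, mul_sub, ← mul_assoc, x_mul_y]; simp

theorem e_mul_y : e K * y K = 0 := by
  rw [e, sub_mul, mul_assoc, x_mul_y]; simp

theorem e_add_y_mul_x : e K + y K * x K = 1 := by simp [e]

theorem e_mul_e : e K * e K = e K := by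
  nth_rw 2 [e]; rw [mul_sub, ← mul_assoc, e_mul_y]; simp

theorem e_mul_of_x_mul_eq_zero {r : Alg K} (h : x K * r = 0) : e K * r = r := by
  rw [e, sub_mul, mul_assoc, h]; simp

theorem y_pow_mul_x_pow_mul {r : Alg K} (h : ∀ n, e K * (x K ^ n * r) = 0) (n : ℕ) :
    y K ^ n * (x K ^ n * r) = r := by
  induction n with
  | zero => simp
  | succ n ih =>
    have h1 : y K * (x K * (x K ^ n * r)) = x K ^ n * r := by
      have := congrArg (· * (x K ^ n * r)) (e_add_y_mul_x (K := K))
      simpa [add_mul, h n, mul_assoc] using this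
    rw [pow_succ, pow_succ', mul_assoc, mul_assoc, h1, ih]

theorem aeval_mul_x_pow (g : K[X]) (n : ℕ) : aeval (x K) g * x K ^ n = x K ^ n * aeval (x K) g := by
  have : x K ^ n = aeval (x K) (X ^ n : K[X]) := by simp
  rw [this, ← map_mul, ← map_mul, mul_comm]

/-- One `x` clears one `y`; products work because powers of `x` commute with polynomials in `x`. -/
theorem exists_x_pow_mul_eq_aeval (r : Alg K) :
    ∃ n, ∃ g : K[X], x K ^ n * r = aeval (x K) g := by
  have key : ∀ {r : Alg K} {n : ℕ} {g : K[X]}, x K ^ n * r = aeval (x K) g → ∀ m,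
      x K ^ (m + n) * r = aeval (x K) (X ^ m * g) := fun h m => by
    rw [pow_add, mul_assoc, h]; simp
  induction r using induction with
  | hK k => exact ⟨0, C k, by simp⟩
  | hx => exact ⟨0, X, by simp⟩
  | hy => exact ⟨1, 1, by simp [x_mul_y]⟩
  | hadd r s hr hs =>
    obtain ⟨n, g, h⟩ := hr
    obtain ⟨m, f, h'⟩ := hs
    refine ⟨m + n, X ^ m * g + X ^ n * f, ?_⟩
    rw [mul_add, key h, add_comm m n, key h', map_add]
  | hmul r s hr hs =>
    obtain ⟨n, g, h⟩ := hr
    obtain ⟨m, f, h'⟩ := hs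
    refine ⟨m + n, g * f, ?_⟩
    rw [pow_add, mul_assoc, ← mul_assoc _ r s, h, ← mul_assoc, ← aeval_mul_x_pow, mul_assoc, h',
      map_mul]

/-- Right multiplication by `y` drops the constant term of `g`, because `e * y = 0`, and lowers the
other exponents. -/
theorem exists_e_mul_aeval_mul (r : Alg K) (g : K[X]) :
    ∃ h : K[X], e K * aeval (x K) g * r = e K * aeval (x K) h := by
  induction r using induction generalizing g with
  | hK k => exact ⟨g * C k, by simp [mul_assoc]⟩
  | hx => exact ⟨g * X, by simp [mul_assoc]⟩
  | hy =>
    refine ⟨g.divX, ?_⟩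
    conv_lhs => rw [← g.divX_mul_X_add]
    rw [map_add, map_mul, aeval_X, aeval_C, mul_add, add_mul, mul_assoc, mul_assoc, x_mul_y,
      mul_assoc, Algebra.commutes, ← mul_assoc (e K) (y K), e_mul_y]
    simp
  | hadd r s hr hs =>
    obtain ⟨h, h1⟩ := hr g
    obtain ⟨h', h2⟩ := hs g
    exact ⟨h + h', by rw [mul_add, h1, h2, map_add, mul_add]⟩
  | hmul r s hr hs =>
    obtain ⟨h, h1⟩ := hr g
    obtain ⟨h', h2⟩ := hs h
    exact ⟨h', by rw [← mul_assoc, h1, h2]⟩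

variable (K) in
/-- The representation of `Alg K` on `K[X]` in which `x` acts by `divX` and `y` by
multiplication by `X`. -/
noncomputable def rep : Alg K →ₐ[K] Module.End K K[X] :=
  lift
    { toFun := divX
      map_add' := fun _ _ => divX_add
      map_smul' := fun k p => by simp [smul_eq_C_mul, divX_C_mul] }
    (LinearMap.mulLeft K X) (by
      refine LinearMap.ext fun p => Polynomial.ext fun n => ?_
      simp [coeff_divX])

theorem rep_x (p : K[X]) : rep K (x K) p = divX p := by rw [rep, lift_x]; rfl

theorem rep_y (p : K[X]) : rep K (y K) p = X * p := by rw [rep, lift_y]; rfl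

theorem rep_e (p : K[X]) : rep K (e K) p = C (p.coeff 0) := by
  rw [e, map_sub, map_one, map_mul, LinearMap.sub_apply, Module.End.mul_apply, rep_x, rep_y,
    Module.End.one_apply, sub_eq_iff_eq_add']
  exact (X_mul_divX_add p).symm

/-- As `x` shifts coefficients down, `X ^ n` tests the `n`-th coefficient of `g`. With `rep_e`, this
makes `g ↦ e * g(x)` injective. -/
theorem coeff_zero_rep_aeval (g : K[X]) (n : ℕ) :
    (rep K (aeval (x K) g) (X ^ n)).coeff 0 = g.coeff n := by
  have hpow : ∀ i p, (rep K (x K ^ i) p).coeff 0 = p.coeff i := by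
    intro i
    induction i with
    | zero => simp
    | succ i ih => intro p; rw [pow_succ, map_mul, Module.End.mul_apply, ih, rep_x, coeff_divX]
  induction g using Polynomial.induction_on' with
  | add p q hp hq => simp [hp, hq]
  | monomial i a =>
    rw [aeval_monomial, map_mul, AlgHom.commutes, Module.End.mul_apply,
      Module.algebraMap_end_apply, coeff_smul, hpow, coeff_X_pow, coeff_monomial]
    simp [eq_comm]

theorem aeval_eq_zero_of_e_mul {g : K[X]} (h : e K * aeval (x K) g = 0) : g = 0 := by
  ext n
  rw [← coeff_zero_rep_aeval, coeff_zero]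
  have := congrArg (fun r => (rep K r (X ^ n)).coeff 0) h
  simpa [rep_e] using this

/-- Some `x ^ n * r` is a polynomial killed by `e`, hence zero, while the hypothesis lets `y ^ n`
undo `x ^ n`. -/
theorem eq_zero_of_e_mul_x_pow_mul {r : Alg K} (h : ∀ n, e K * (x K ^ n * r) = 0) : r = 0 := by
  obtain ⟨n, g, hg⟩ := exists_x_pow_mul_eq_aeval r
  have h0 := h n
  rw [hg] at h0
  rw [← y_pow_mul_x_pow_mul h n, hg, aeval_eq_zero_of_e_mul h0]
  simp

theorem e_ne_zero : e K ≠ 0 := fun h =>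
  one_ne_zero (aeval_eq_zero_of_e_mul (K := K) (g := 1) (by simp [h]))

instance : Nontrivial (Alg K) := ⟨e K, 0, e_ne_zero⟩

theorem aeval_mul_e (g : K[X]) : aeval (x K) g * e K = g.coeff 0 • e K := by
  conv_lhs => rw [← g.divX_mul_X_add]
  rw [map_add, map_mul, aeval_X, aeval_C, add_mul, mul_assoc, x_mul_e, mul_zero, zero_add,
    Algebra.smul_def]

theorem exists_x_pow_mul_mul_e (r : Alg K) : ∃ n, x K ^ n * (r * e K) = 0 := by
  obtain ⟨n, g, hg⟩ := exists_x_pow_mul_eq_aeval r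
  refine ⟨n + 1, ?_⟩
  rw [pow_succ', mul_assoc, ← mul_assoc _ r, hg, aeval_mul_e, mul_smul_comm, x_mul_e, smul_zero]

theorem e_mem_S : e K ∈ S K := Ideal.subset_span rfl

theorem mem_S {s : Alg K} : s ∈ S K ↔ s * e K = s := by
  constructor
  · intro h
    obtain ⟨a, rfl⟩ := Ideal.mem_span_singleton'.1 h
    change a * e K * e K = a * e K
    rw [mul_assoc, e_mul_e]
  · intro h
    rw [← h]
    exact Ideal.mul_mem_left _ _ e_mem_S

/-- Here `s = e * s * e`, and `e * g(x) * e = g(0) • e`. -/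
theorem exists_smul_e_of_x_mul_eq_zero {s : Alg K} (hs : s ∈ S K) (h : x K * s = 0) :
    ∃ k : K, s = k • e K := by
  obtain ⟨g, hg⟩ := exists_e_mul_aeval_mul s 1
  rw [map_one, mul_one, e_mul_of_x_mul_eq_zero h] at hg
  refine ⟨g.coeff 0, ?_⟩
  rw [← mem_S.1 hs, hg, mul_assoc, aeval_mul_e, mul_smul_comm, e_mul_e]

theorem exists_aeval_of_x_mul_eq_zero {r : Alg K} (h : x K * r = 0) :
    ∃ g : K[X], r = e K * aeval (x K) g := by
  obtain ⟨g, hg⟩ := exists_e_mul_aeval_mul r 1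
  rw [map_one, mul_one, e_mul_of_x_mul_eq_zero h] at hg
  exact ⟨g, hg⟩

variable (K) in
/-- The augmentation `x, y ↦ 1`. -/
noncomputable def aug : Alg K →ₐ[K] K := lift 1 1 (one_mul 1)

theorem aug_e : aug K (e K) = 0 := by
  rw [e, map_sub, map_mul, aug, lift_x, lift_y]; simp

theorem aug_of_mem_S {s : Alg K} (hs : s ∈ S K) : aug K s = 0 := by
  rw [← mem_S.1 hs, map_mul, aug_e, mul_zero]

end Algebra

end ToeplitzJacobson

/-! ### Decomposition of projective modules -/

namespace ToeplitzJacobson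

open Polynomial

section Structure

variable {K : Type*} [Field K]

/-- A homomorphism out of an `x`-torsion module is injective as soon as it is injective on
the kernel of `x`. -/
theorem injective_of_x_torsion {M N : Type*} [AddCommGroup M] [Module (Alg K) M]
    [AddCommGroup N] [Module (Alg K) N] (f : M →ₗ[Alg K] N)
    (htors : ∀ m : M, ∃ n, x K ^ n • m = 0) (hf : ∀ m : M, x K • m = 0 → f m = 0 → m = 0) :
    Function.Injective f := by
  rw [injective_iff_map_eq_zero]
  intro m hm
  obtain ⟨n, hn⟩ := htors m
  induction n with
  | zero => simpa using hn
  | succ n ih =>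
    exact ih (hf _ (by rw [← mul_smul, ← pow_succ', hn]) (by rw [map_smul, hm, smul_zero]))

theorem x_torsion_S (s : S K) : ∃ n, x K ^ n • s = 0 := by
  obtain ⟨n, hn⟩ := exists_x_pow_mul_mul_e (s : Alg K)
  rw [mem_S.1 s.2] at hn
  exact ⟨n, Subtype.ext hn⟩

noncomputable instance {κ : Type*} : AddCommGroup (κ →₀ S K) :=
  Module.addCommMonoidToAddCommGroup (Alg K)

theorem x_torsion_finsupp {κ : Type*} (c : κ →₀ S K) : ∃ n, x K ^ n • c = 0 := by
  induction c using Finsupp.induction_linear with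
  | zero => exact ⟨0, smul_zero _⟩
  | add f g hf hg =>
    obtain ⟨n, hn⟩ := hf
    obtain ⟨m, hm⟩ := hg
    refine ⟨n + m, ?_⟩
    have h1 : x K ^ (n + m) • f = 0 := by rw [add_comm, pow_add, mul_smul, hn, smul_zero]
    have h2 : x K ^ (n + m) • g = 0 := by rw [pow_add, mul_smul, hm, smul_zero]
    rw [smul_add, h1, h2, add_zero]
  | single k s =>
    obtain ⟨n, hn⟩ := x_torsion_S s
    exact ⟨n, by rw [Finsupp.smul_single, hn, Finsupp.single_zero]⟩

theorem e_smul_of_x_smul {N : Type*} [AddCommGroup N] [Module (Alg K) N] {v : N}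
    (h : x K • v = 0) : e K • v = v := by
  rw [e, sub_smul, mul_smul, h, smul_zero, sub_zero, one_smul]

/-- An `x`-torsion module is a direct sum of copies of `S`. -/
theorem exists_equiv_finsupp_S_of_x_torsion {N : Type v} [AddCommGroup N] [Module (Alg K) N]
    (htors : ∀ m : N, ∃ n, x K ^ n • m = 0) :
    ∃ κ : Type v, Nonempty ((κ →₀ S K) ≃ₗ[Alg K] N) := by
  let _ : Module K N := Module.compHom N (algebraMap K (Alg K))
  have hK : ∀ (k : K) (m : N), k • m = algebraMap K (Alg K) k • m := fun _ _ => rfl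
  let V : Submodule K N :=
    { carrier := {v | x K • v = 0}
      add_mem' := fun {a b} ha hb => by
        change x K • (a + b) = 0
        rw [smul_add, ha, hb, add_zero]
      zero_mem' := smul_zero _
      smul_mem' := fun k v hv => by
        change x K • (k • v) = 0
        rw [hK, ← mul_smul, ← Algebra.commutes, mul_smul, hv, smul_zero] }
  let b := Module.Basis.ofVectorSpace K V
  let κ : Type v := Module.Basis.ofVectorSpaceIndex K V
  -- Each basis vector of the kernel of `x` is fixed by `e`, so it generates a copy of `S` through
  -- `s ↦ s • b k`.
  let Φ : (κ →₀ S K) →ₗ[Alg K] N :=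
    Finsupp.lsum ℕ fun k => (LinearMap.toSpanSingleton (Alg K) N (b k : N)).comp (S K).subtype
  have hΦ : ∀ c : κ →₀ S K, Φ c = c.sum fun k s => (s : Alg K) • (b k : N) := fun c => rfl
  have he : ∀ v : N, v ∈ V → v ∈ LinearMap.range Φ := by
    intro v hv
    have : (⟨v, hv⟩ : V) ∈ Submodule.span K (Set.range b) := by rw [b.span_eq]; trivial
    have h2 : v ∈ Submodule.span K (V.subtype '' Set.range b) := by
      rw [← Submodule.map_span]
      exact ⟨_, this, rfl⟩
    clear this hv
    induction h2 using Submodule.span_induction with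
    | mem w hw =>
      obtain ⟨_, ⟨k, rfl⟩, rfl⟩ := hw
      refine ⟨Finsupp.single k ⟨e K, e_mem_S⟩, ?_⟩
      rw [hΦ, Finsupp.sum_single_index (by simp)]
      exact e_smul_of_x_smul (b k).2
    | zero => exact zero_mem _
    | add w w' _ _ h h' => exact add_mem h h'
    | smul k w _ h => exact Submodule.smul_mem _ (algebraMap K (Alg K) k) h
  refine ⟨κ, ⟨LinearEquiv.ofBijective Φ ⟨?_, ?_⟩⟩⟩
  · refine injective_of_x_torsion (M := κ →₀ S K) Φ x_torsion_finsupp fun c hc h0 => ?_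
    have h1 : ∀ k, ∃ l : K, (c k : Alg K) = l • e K := fun k =>
      exists_smul_e_of_x_mul_eq_zero (c k).2 (congrArg (fun c => (c k : Alg K)) hc)
    choose l hl using h1
    rw [hΦ, Finsupp.sum] at h0
    have h2 : ∑ k ∈ c.support, l k • b k = 0 := by
      apply Subtype.ext
      rw [Submodule.coe_sum, Submodule.coe_zero, ← h0]
      refine Finset.sum_congr rfl fun k _ => ?_
      rw [hl, Algebra.smul_def, mul_smul, e_smul_of_x_smul (b k).2]
      rfl
    have h3 := linearIndependent_iff'.1 b.linearIndependent _ _ h2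
    ext k
    by_cases hk : k ∈ c.support
    · rw [hl, h3 k hk]; simp
    · rw [Finsupp.notMem_support_iff.1 hk]; rfl
  · intro m
    rw [← LinearMap.mem_range]
    obtain ⟨n, hn⟩ := htors m
    induction n generalizing m with
    | zero => rw [show m = 0 by simpa using hn]; exact zero_mem _
    | succ n ih =>
      have h1 := ih (x K • m) (by rw [← mul_smul, ← pow_succ, hn])
      -- The first term lies in the kernel of `x`; in the second, `x • m` is killed by a smaller
      -- power of `x`.
      have h2 : m = e K • m + y K • x K • m := by
        rw [← mul_smul, ← add_smul, e_add_y_mul_x, one_smul]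
      rw [h2]
      refine add_mem (he _ ?_) (Submodule.smul_mem _ _ h1)
      change x K • e K • m = 0
      rw [← mul_smul, x_mul_e, zero_smul]

instance : Module.Projective (Alg K) (S K) :=
  Module.Projective.of_split (M := Alg K) (S K).subtype
    ((LinearMap.toSpanSingleton (Alg K) (Alg K) (e K)).codRestrict (S K) fun _ =>
      Ideal.mul_mem_left _ _ e_mem_S)
    (LinearMap.ext fun s => Subtype.ext (mem_S.1 s.2))

theorem projective_finsupp {ι M : Type*} [AddCommMonoid M] [Module (Alg K) M]
    [Module.Projective (Alg K) M] : Module.Projective (Alg K) (ι →₀ M) := by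
  classical
  have e : (ι →₀ M) ≃ₗ[Alg K] Π₀ _ : ι, M := finsuppLequivDFinsupp (Alg K)
  exact Module.Projective.of_equiv e.symm

/-- Coefficientwise evaluation at `x` of a finitely supported family of polynomials. -/
noncomputable def evalX (J : Type*) : (J →₀ K[X]) →+ (J →₀ Alg K) :=
  Finsupp.mapRange.addMonoidHom ((aeval (x K) : K[X] →ₐ[K] Alg K) : K[X] →+ Alg K)

theorem evalX_apply {J : Type*} (f : J →₀ K[X]) (j : J) : evalX J f j = aeval (x K) (f j) := rfl

theorem evalX_smul {J : Type*} (g : K[X]) (f : J →₀ K[X]) :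
    evalX J (g • f) = aeval (x K) g • evalX J f := by
  ext j; simp [evalX_apply]

theorem exists_x_pow_smul_eq_evalX {J : Type*} (f : J →₀ Alg K) :
    ∃ n, ∃ g, x K ^ n • f = evalX J g := by
  induction f using Finsupp.induction_linear with
  | zero => exact ⟨0, 0, by simp⟩
  | add f g hf hg =>
    obtain ⟨n, a, hn⟩ := hf
    obtain ⟨m, b, hm⟩ := hg
    refine ⟨n + m, (X ^ m : K[X]) • a + (X ^ n : K[X]) • b, ?_⟩
    rw [map_add, evalX_smul, evalX_smul, ← hn, ← hm, map_pow, map_pow, aeval_X, ← mul_smul,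
      ← mul_smul, ← pow_add, ← pow_add, add_comm m n, smul_add]
  | single j r =>
    obtain ⟨n, g, h⟩ := exists_x_pow_mul_eq_aeval r
    refine ⟨n, Finsupp.single j g, ?_⟩
    rw [Finsupp.smul_single, smul_eq_mul, h]
    exact (Finsupp.mapRange_single (f := aeval (x K)) (hf := map_zero _)).symm

/-- `Alg K` is flat as a right module over `K[x]`, in the form of a statement about linear
independence. -/
theorem linearIndependent_evalX {ι J : Type*} {b : ι → J →₀ K[X]} (hb : LinearIndependent K[X] b) :
    LinearIndependent (Alg K) fun i => evalX J (b i) := by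
  refine (linearIndependent_iff' (R := Alg K) (M := J →₀ Alg K)).2 fun s r hr i hi => ?_
  refine eq_zero_of_e_mul_x_pow_mul fun n => ?_
  -- Applying `e * x ^ n` on the left turns the relation over `R` into one with polynomial
  -- coefficients.
  have h1 : ∀ i, ∃ h : K[X], e K * (x K ^ n * r i) = e K * aeval (x K) h := fun i => by
    obtain ⟨h, hh⟩ := exists_e_mul_aeval_mul (r i) (X ^ n)
    exact ⟨h, by rw [← hh, map_pow, aeval_X, mul_assoc]⟩
  choose h hh using h1
  have h2 : ∑ i ∈ s, h i • b i = 0 := by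
    ext1 j
    refine aeval_eq_zero_of_e_mul ?_
    have := congrArg (fun f => e K * (x K ^ n * f j)) hr
    simp only [Finsupp.finsetSum_apply, Finsupp.smul_apply, evalX_apply, smul_eq_mul,
      Finsupp.zero_apply, mul_zero, Finset.mul_sum] at this
    rw [Finsupp.finsetSum_apply, map_sum, Finset.mul_sum, ← this]
    refine Finset.sum_congr rfl fun i _ => ?_
    rw [Finsupp.smul_apply, smul_eq_mul, map_mul, ← mul_assoc, ← hh, mul_assoc, mul_assoc]
  rw [hh, linearIndependent_iff'.1 hb _ _ h2 i hi]
  simp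

/-- The finitely supported families of polynomials whose evaluation at `x` lies in `Q`. -/
noncomputable def polyPart {J : Type*} (Q : Submodule (Alg K) (J →₀ Alg K)) :
    Submodule K[X] (J →₀ K[X]) where
  carrier := {f | evalX J f ∈ Q}
  add_mem' ha hb := by
    rw [Set.mem_ofPred_eq, map_add]; exact add_mem ha hb
  zero_mem' := by rw [Set.mem_ofPred_eq, map_zero]; exact zero_mem _
  smul_mem' g f hf := by
    rw [Set.mem_ofPred_eq, evalX_smul]; exact Submodule.smul_mem _ _ hf

/-- A submodule of a free module is an extension of an `x`-torsion module by a free module. -/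
theorem exists_linearIndependent_x_torsion {J : Type*} {P : Type v} [AddCommGroup P]
    [Module (Alg K) P] (s : P →ₗ[Alg K] (J →₀ Alg K)) (hs : Function.Injective s) :
    ∃ T : Set P, LinearIndependent (Alg K) ((↑) : T → P) ∧
      ∀ p : P, ∃ n, x K ^ n • p ∈ Submodule.span (Alg K) T := by
  let N := polyPart (LinearMap.range s)
  have := N.free_of_finsupp_of_pid
  obtain ⟨⟨I, b⟩⟩ := Module.Free.exists_basis K[X] N
  have hN : ∀ i, ∃ p, s p = evalX J (b i) := fun i => (b i).2
  choose p hp using hN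
  have hli : LinearIndependent (Alg K) p := by
    refine LinearIndependent.of_comp (R := Alg K) (M' := J →₀ Alg K) s ?_
    have h1 : LinearIndependent K[X] fun i => (b i : J →₀ K[X]) :=
      b.linearIndependent.map_injOn N.subtype N.injective_subtype.injOn
    convert linearIndependent_evalX h1 using 1
    ext1 i
    exact hp i
  refine ⟨Set.range p, hli.linearIndepOn_id, fun q => ?_⟩
  obtain ⟨n, g, hg⟩ := exists_x_pow_smul_eq_evalX (s q)
  refine ⟨n, ?_⟩
  -- The polynomial vectors of `P` already lie in the `R`-span of the `p i`, and some `x ^ n • q` is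
  -- such a vector.
  have hle : N ≤ polyPart ((Submodule.span (Alg K) (Set.range p)).map s) := by
    have h1 : (Submodule.span K[X] (Set.range b)).map N.subtype = N := by
      rw [b.span_eq, Submodule.map_top, Submodule.range_subtype]
    refine h1.symm.le.trans ?_
    rw [Submodule.map_span, Submodule.span_le]
    rintro _ ⟨_, ⟨i, rfl⟩, rfl⟩
    exact ⟨p i, Submodule.subset_span ⟨i, rfl⟩, hp i⟩
  have hgN : g ∈ N := ⟨x K ^ n • q, by rw [map_smul, hg]⟩
  obtain ⟨q', hq', h⟩ := hle hgN
  rw [← hg, ← map_smul] at h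
  rwa [← hs h]

/-- Every projective module is a direct sum of copies of `Alg K` and `S K`. -/
theorem exists_equiv_prod {P : Type v} [AddCommGroup P] [Module (Alg K) P]
    [Module.Projective (Alg K) P] :
    ∃ ι κ : Type v, Nonempty (P ≃ₗ[Alg K] (ι →₀ Alg K) × (κ →₀ S K)) := by
  obtain ⟨s, hs⟩ := Module.projective_def'.1 ‹Module.Projective (Alg K) P›
  obtain ⟨T, hT, htors⟩ := exists_linearIndependent_x_torsion s
    (Function.LeftInverse.injective (g := Finsupp.linearCombination (Alg K) id)
      fun p => LinearMap.congr_fun hs p)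
  let Q := Submodule.span (Alg K) T
  obtain ⟨κ, ⟨φ⟩⟩ := exists_equiv_finsupp_S_of_x_torsion (N := P ⧸ Q) fun m => by
    obtain ⟨p, rfl⟩ := Q.mkQ_surjective m
    obtain ⟨n, hn⟩ := htors p
    exact ⟨n, by rw [← map_smul]; exact (Submodule.Quotient.mk_eq_zero _).2 hn⟩
  have : Module.Projective (Alg K) (κ →₀ S K) := projective_finsupp
  have : Module.Projective (Alg K) (P ⧸ Q) := Module.Projective.of_equiv φ
  obtain ⟨t, ht⟩ := Module.projective_lifting_property Q.mkQ LinearMap.id Q.mkQ_surjective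
  have ht' : ∀ m, Q.mkQ (t m) = m := fun m => LinearMap.congr_fun ht m
  have hT' : Module.Basis T (Alg K) Q := by
    have := Module.Basis.span hT
    rwa [Subtype.range_coe] at this
  have hc : IsCompl Q (LinearMap.range t) := by
    refine ⟨Submodule.disjoint_def.2 ?_, Submodule.codisjoint_iff_exists_add_eq.2 fun v =>
      ⟨v - t (Q.mkQ v), t (Q.mkQ v), ?_, ⟨_, rfl⟩, sub_add_cancel _ _⟩⟩
    · rintro _ hv ⟨m, rfl⟩
      rw [← ht' m, Submodule.mkQ_apply, (Submodule.Quotient.mk_eq_zero Q).2 hv, map_zero]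
    · rw [← Submodule.Quotient.mk_eq_zero Q, ← Submodule.mkQ_apply, map_sub, ht', sub_self]
  let ψ : LinearMap.range t ≃ₗ[Alg K] P ⧸ Q := (LinearEquiv.ofInjective t
    (Function.LeftInverse.injective ht')).symm
  exact ⟨T, κ, ⟨(Submodule.prodEquivOfIsCompl _ _ hc).symm.trans
    (LinearEquiv.prodCongr hT'.repr (ψ.trans φ.symm))⟩⟩

end Structure

end ToeplitzJacobson

/-! ### Absorption of copies of `S` and normal forms -/

namespace ToeplitzJacobson

open Polynomial Cardinal

section Absorption

variable {K : Type*} [Field K]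

theorem y_mul_x_add_e (r : Alg K) : r * y K * x K + r * e K = r := by
  rw [mul_assoc, ← mul_add, add_comm, e_add_y_mul_x, mul_one]

/-- `Alg K ≃ Alg K × S K`, applied coefficientwise. -/
theorem nonempty_finsupp_equiv_prod (κ : Type*) :
    Nonempty ((κ →₀ Alg K) ≃ₗ[Alg K] (κ →₀ Alg K) × (κ →₀ S K)) := by
  let mulRight (a : Alg K) : Alg K →ₗ[Alg K] Alg K := LinearMap.toSpanSingleton _ _ a
  have hm : ∀ a r, mulRight a r = r * a := fun _ _ => rfl
  let toS : Alg K →ₗ[Alg K] S K := (mulRight (e K)).codRestrict (S K) fun _ =>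
    Ideal.mul_mem_left _ _ e_mem_S
  have ht : ∀ r, (toS r : Alg K) = r * e K := fun _ => rfl
  have hsy : ∀ s : S K, (s : Alg K) * y K = 0 := fun s => by
    rw [← mem_S.1 s.2, mul_assoc, e_mul_y, mul_zero]
  -- The inverse maps are `r ↦ (r * y, r * e)` and `(a, s) ↦ a * x + s`.
  refine ⟨LinearEquiv.ofLinearMap
    ((Finsupp.mapRange.linearMap (mulRight (y K))).prod (Finsupp.mapRange.linearMap toS))
    ((Finsupp.mapRange.linearMap (mulRight (x K))).coprod
      (Finsupp.mapRange.linearMap (S K).subtype)) ?_ ?_⟩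
  · refine LinearMap.ext fun z => Prod.ext (Finsupp.ext fun k => ?_)
      (Finsupp.ext fun k => Subtype.ext ?_)
    · simp [hm, add_mul, mul_assoc, x_mul_y, hsy]
    · simp [hm, ht, mul_assoc, x_mul_e, mem_S.1 (z.2 k).2]
  · refine LinearMap.ext fun z => Finsupp.ext fun k => ?_
    simp [hm, ht, y_mul_x_add_e]

theorem nonempty_equiv_of_mk_eq {ι κ ι' κ' : Type v} (h : #ι = #ι') (h' : #κ = #κ') :
    Nonempty (((ι →₀ Alg K) × (κ →₀ S K)) ≃ₗ[Alg K] (ι' →₀ Alg K) × (κ' →₀ S K)) := by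
  obtain ⟨a⟩ := Cardinal.eq.1 h
  obtain ⟨b⟩ := Cardinal.eq.1 h'
  exact ⟨LinearEquiv.prodCongr (Finsupp.domLCongr a) (Finsupp.domLCongr b)⟩

/-- Split `κ` copies of `R` off the free part and turn each into `R ⊕ S`. -/
theorem nonempty_absorb_of_mk_add_eq {ι κ : Type v} (h : #ι + #κ = #ι) :
    Nonempty (((ι →₀ Alg K) × (κ →₀ S K)) ≃ₗ[Alg K] (ι →₀ Alg K)) := by
  obtain ⟨a⟩ := Cardinal.eq.1 ((mk_sum ι κ).trans (by simpa using h))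
  obtain ⟨f⟩ := nonempty_finsupp_equiv_prod (K := K) κ
  let g : (ι →₀ Alg K) ≃ₗ[Alg K] (ι →₀ Alg K) × (κ →₀ Alg K) :=
    (Finsupp.domLCongr a).symm.trans (Finsupp.sumFinsuppLEquivProdFinsupp (Alg K))
  exact ⟨((g.trans (LinearEquiv.prodCongr (LinearEquiv.refl _ _) f)).trans
    ((LinearEquiv.prodAssoc _ _ _ _).symm.trans
      (LinearEquiv.prodCongr g.symm (LinearEquiv.refl _ _)))).symm⟩

/-- A single copy of `R` absorbs the copies of `S` one at a time, so `ι` may be finite. -/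
theorem nonempty_absorb_of_finite {ι : Type v} [Nonempty ι] (κ : Type v) [Finite κ] :
    Nonempty (((ι →₀ Alg K) × (κ →₀ S K)) ≃ₗ[Alg K] (ι →₀ Alg K)) := by
  have hunit : Nonempty (((ι →₀ Alg K) × (PUnit.{v + 1} →₀ S K)) ≃ₗ[Alg K] (ι →₀ Alg K)) := by
    obtain ⟨f⟩ := nonempty_finsupp_equiv_prod (K := K) PUnit.{v + 1}
    classical
    obtain ⟨i⟩ := ‹Nonempty ι›
    let a : {j // j ≠ i} ⊕ PUnit.{v + 1} ≃ ι :=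
      (Equiv.optionEquivSumPUnit _).symm.trans (Equiv.optionSubtypeNe i)
    let g : (ι →₀ Alg K) ≃ₗ[Alg K] ({j // j ≠ i} →₀ Alg K) × (PUnit.{v + 1} →₀ Alg K) :=
      (Finsupp.domLCongr a).symm.trans (Finsupp.sumFinsuppLEquivProdFinsupp (Alg K))
    exact ⟨((g.trans (LinearEquiv.prodCongr (LinearEquiv.refl _ _) f)).trans
      ((LinearEquiv.prodAssoc _ _ _ _).symm.trans
        (LinearEquiv.prodCongr g.symm (LinearEquiv.refl _ _)))).symm⟩
  induction κ using Finite.induction_empty_option with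
  | of_equiv a h =>
    obtain ⟨h⟩ := h
    exact ⟨(LinearEquiv.prodCongr (LinearEquiv.refl _ _) (Finsupp.domLCongr a)).symm.trans h⟩
  | h_empty => exact ⟨LinearEquiv.prodUnique⟩
  | h_option h =>
    rename_i κ _
    obtain ⟨h⟩ := h
    obtain ⟨f⟩ := hunit
    let g : (Option κ →₀ S K) ≃ₗ[Alg K] (κ →₀ S K) × (PUnit.{v + 1} →₀ S K) :=
      (Finsupp.domLCongr (Equiv.optionEquivSumPUnit κ)).trans
        (Finsupp.sumFinsuppLEquivProdFinsupp (Alg K))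
    exact ⟨((LinearEquiv.prodCongr (LinearEquiv.refl _ _) g).trans
      (LinearEquiv.prodAssoc _ _ _ _).symm).trans
      ((LinearEquiv.prodCongr h (LinearEquiv.refl _ _)).trans f)⟩

theorem exists_isNormalized (ι κ : Type v) :
    ∃ α β : Cardinal.{v}, IsNormalized α β ∧
      Nonempty (((ι →₀ Alg K) × (κ →₀ S K)) ≃ₗ[Alg K] DirectSumRS K α β) := by
  have hself : IsNormalized #ι #κ → ∃ α β : Cardinal.{v}, IsNormalized α β ∧
      Nonempty (((ι →₀ Alg K) × (κ →₀ S K)) ≃ₗ[Alg K] DirectSumRS K α β) := fun h =>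
    ⟨_, _, h, nonempty_equiv_of_mk_eq (mk_out _).symm (mk_out _).symm⟩
  have habs : Nonempty (((ι →₀ Alg K) × (κ →₀ S K)) ≃ₗ[Alg K] (ι →₀ Alg K)) →
      ∃ α β : Cardinal.{v}, IsNormalized α β ∧
        Nonempty (((ι →₀ Alg K) × (κ →₀ S K)) ≃ₗ[Alg K] DirectSumRS K α β) := by
    rintro ⟨f⟩
    obtain ⟨g⟩ := nonempty_equiv_of_mk_eq (K := K) (ι := ι) (κ := PEmpty.{v + 1})
      (mk_out #ι).symm (mk_out _).symm
    refine ⟨#ι, #PEmpty.{v + 1}, ?_, ⟨f.trans (LinearEquiv.prodUnique.symm.trans g)⟩⟩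
    rw [mk_pempty]
    rcases lt_or_ge #ι ℵ₀ with h | h
    exacts [Or.inl ⟨h, Or.inl rfl⟩, Or.inr (Or.inl ⟨h, Or.inl rfl⟩)]
  rcases lt_or_ge #ι ℵ₀ with h | h
  · rcases lt_or_ge #κ ℵ₀ with h' | h'
    · rcases isEmpty_or_nonempty ι with hι | hι
      · exact hself (Or.inr (Or.inr ⟨mk_eq_zero ι, h'⟩))
      · have := lt_aleph0_iff_finite.1 h'
        exact habs (nonempty_absorb_of_finite κ)
    · exact hself (Or.inl ⟨h, Or.inr h'⟩)
  · rcases lt_or_ge #ι #κ with h' | h'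
    · exact hself (Or.inr (Or.inl ⟨h, Or.inr h'⟩))
    · exact habs (nonempty_absorb_of_mk_add_eq (add_eq_left h h'))

end Absorption

/-! ### Isomorphism invariants and uniqueness -/

section Invariants

variable {K : Type*} [Field K]

/-- A parametrization of the kernel of `x` on a direct sum of copies of `Alg K` and `S K`. -/
noncomputable def kerParam (ι κ : Type*) :
    ((ι →₀ K[X]) × (κ →₀ K)) →ₗ[K] (ι →₀ Alg K) × (κ →₀ S K) :=
  LinearMap.prodMap
    (Finsupp.mapRange.linearMap ((LinearMap.mulLeft K (e K)).comp (aeval (x K)).toLinearMap))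
    (Finsupp.mapRange.linearMap (LinearMap.toSpanSingleton K (S K) ⟨e K, e_mem_S⟩))

theorem kerParam_fst {ι κ : Type*} (z : (ι →₀ K[X]) × (κ →₀ K)) (i : ι) :
    (kerParam ι κ z).1 i = e K * aeval (x K) (z.1 i) := rfl

theorem kerParam_snd {ι κ : Type*} (z : (ι →₀ K[X]) × (κ →₀ K)) (k : κ) :
    ((kerParam ι κ z).2 k : Alg K) = z.2 k • e K := rfl

theorem kerParam_injective (ι κ : Type*) : Function.Injective (kerParam (K := K) ι κ) := by
  intro z w h
  have hsmul : ∀ k : K, k • e K = e K * aeval (x K) (C k) := fun k => by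
    rw [aeval_C, ← Algebra.commutes, Algebra.smul_def]
  refine Prod.ext (Finsupp.ext fun i => ?_) (Finsupp.ext fun k => C_injective ?_) <;>
    refine sub_eq_zero.1 (aeval_eq_zero_of_e_mul ?_)
  · rw [map_sub, mul_sub, ← kerParam_fst, ← kerParam_fst, h, sub_self]
  · rw [map_sub, mul_sub, ← hsmul, ← hsmul, ← kerParam_snd, ← kerParam_snd, h, sub_self]

theorem mem_range_kerParam {ι κ : Type*} {z : (ι →₀ Alg K) × (κ →₀ S K)} :
    z ∈ LinearMap.range (kerParam ι κ) ↔ x K • z = 0 := by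
  constructor
  · rintro ⟨w, rfl⟩
    refine Prod.ext (Finsupp.ext fun i => ?_) (Finsupp.ext fun k => Subtype.ext ?_)
    · change x K * (kerParam ι κ w).1 i = 0
      rw [kerParam_fst, ← mul_assoc, x_mul_e, zero_mul]
    · change x K * ((kerParam ι κ w).2 k : Alg K) = 0
      rw [kerParam_snd, mul_smul_comm, x_mul_e, smul_zero]
  · intro h
    have h1 : ∀ i, ∃ g : K[X], z.1 i = e K * aeval (x K) g := fun i =>
      exists_aeval_of_x_mul_eq_zero (congrArg (fun z => z.1 i) h)
    have h2 : ∀ k, ∃ l : K, (z.2 k : Alg K) = l • e K := fun k =>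
      exists_smul_e_of_x_mul_eq_zero (z.2 k).2 (congrArg (fun z => (z.2 k : Alg K)) h)
    choose g hg using h1
    choose l hl using h2
    -- The chosen coefficients vanish wherever `z` does, by injectivity of `g ↦ e * g(x)` and `e ≠
    -- 0`, so they are finitely supported.
    refine ⟨(Finsupp.onFinset z.1.support g fun i hi => Finsupp.mem_support_iff.2 fun h0 => hi ?_,
      Finsupp.onFinset z.2.support l fun k hk => Finsupp.mem_support_iff.2 fun h0 => hk ?_), ?_⟩
    · exact aeval_eq_zero_of_e_mul (by rw [← hg, h0])
    · have : l k • e K = 0 := by rw [← hl, h0]; rfl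
      exact (smul_eq_zero.1 this).resolve_right e_ne_zero
    · refine Prod.ext (Finsupp.ext fun i => ?_) (Finsupp.ext fun k => Subtype.ext ?_)
      · rw [kerParam_fst, hg]; rfl
      · rw [kerParam_snd, hl]; rfl

/-- The dimension of the kernel of `x` is an isomorphism invariant. -/
theorem mk_mul_aleph0_add_mk_eq {ι κ ι' κ' : Type v}
    (φ : ((ι →₀ Alg K) × (κ →₀ S K)) ≃ₗ[Alg K] (ι' →₀ Alg K) × (κ' →₀ S K)) :
    #ι * ℵ₀ + #κ = #ι' * ℵ₀ + #κ' := by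
  let f := ((φ.restrictScalars K).toLinearMap).comp (kerParam ι κ)
  have hf : Function.Injective f := φ.injective.comp (kerParam_injective ι κ)
  have hr : LinearMap.range f = LinearMap.range (kerParam ι' κ') := by
    ext z
    rw [mem_range_kerParam]
    constructor
    · rintro ⟨w, rfl⟩
      change x K • φ (kerParam ι κ w) = 0
      rw [← map_smul, mem_range_kerParam.1 ⟨w, rfl⟩, map_zero]
    · intro hz
      obtain ⟨w, hw⟩ := mem_range_kerParam (z := φ.symm z) |>.2 (by rw [← map_smul, hz, map_zero])
      refine ⟨w, ?_⟩
      change φ (kerParam ι κ w) = z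
      rw [hw, φ.apply_symm_apply]
  let ψ := (LinearEquiv.ofInjective f hf).trans
    ((LinearEquiv.ofEq _ _ hr).trans (LinearEquiv.ofInjective _ (kerParam_injective ι' κ')).symm)
  let b (ι κ : Type v) : Module.Basis ((Σ _ : ι, ℕ) ⊕ κ) K ((ι →₀ K[X]) × (κ →₀ K)) :=
    (Finsupp.basis fun _ => Polynomial.basisMonomials K).prod Finsupp.basisSingleOne
  simpa using mk_eq_mk_of_basis' ((b ι κ).map ψ) (b ι' κ')

/-- The submodule generated by the multiples by elements of the augmentation ideal. -/
noncomputable def augPart (K : Type*) [Field K] (M : Type*) [AddCommMonoid M] [Module (Alg K) M] :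
    Submodule (Alg K) M :=
  Submodule.span (Alg K) {z | ∃ (r : Alg K) (m : M), aug K r = 0 ∧ z = r • m}

theorem map_mem_augPart {M M' : Type*} [AddCommMonoid M] [Module (Alg K) M] [AddCommMonoid M']
    [Module (Alg K) M'] (φ : M →ₗ[Alg K] M') {z : M} (hz : z ∈ augPart K M) :
    φ z ∈ augPart K M' := by
  induction hz using Submodule.span_induction with
  | mem z hz =>
    obtain ⟨r, m, hr, rfl⟩ := hz
    exact Submodule.subset_span ⟨r, φ m, hr, map_smul _ _ _⟩
  | zero => rw [map_zero]; exact zero_mem _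
  | add a b _ _ ha hb => rw [map_add]; exact add_mem ha hb
  | smul r a _ ha => rw [map_smul]; exact Submodule.smul_mem _ _ ha

/-- The coefficientwise augmentation. -/
noncomputable def augMap (ι κ : Type*) : ((ι →₀ Alg K) × (κ →₀ S K)) →ₗ[K] (ι →₀ K) :=
  (Finsupp.mapRange.linearMap (aug K).toLinearMap).comp (LinearMap.fst K _ _)

theorem augMap_apply {ι κ : Type*} (z : (ι →₀ Alg K) × (κ →₀ S K)) (i : ι) :
    augMap ι κ z i = aug K (z.1 i) := rfl

theorem augMap_smul {ι κ : Type*} (r : Alg K) (z : (ι →₀ Alg K) × (κ →₀ S K)) :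
    augMap ι κ (r • z) = aug K r • augMap ι κ z := by
  ext i
  simp [augMap_apply]

theorem augMap_surjective (ι κ : Type*) : Function.Surjective (augMap (K := K) ι κ) := by
  intro f
  refine ⟨(f.mapRange (algebraMap K (Alg K)) (map_zero _), 0), Finsupp.ext fun i => ?_⟩
  simp [augMap_apply]

/-- This describes the kernel without coordinates, so isomorphisms preserve it. Copies of `S` lie in
it because `s = s * e` with `aug s = 0`. -/
theorem augMap_eq_zero_iff {ι κ : Type*} {z : (ι →₀ Alg K) × (κ →₀ S K)} :
    augMap ι κ z = 0 ↔ z ∈ augPart K ((ι →₀ Alg K) × (κ →₀ S K)) := by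
  constructor
  · intro h
    have h1 : z = (z.1.sum fun i r => r • (Finsupp.single i 1, 0)) +
        z.2.sum fun k s => (s : Alg K) • (0, Finsupp.single k ⟨e K, e_mem_S⟩) := by
      have hs : ∀ s : S K, (s : Alg K) • (⟨e K, e_mem_S⟩ : S K) = s := fun s =>
        Subtype.ext (mem_S.1 s.2)
      refine Prod.ext ?_ ?_
      · simp [Finsupp.sum, Prod.fst_sum]
        exact (Finsupp.sum_single z.1).symm
      · simp [Finsupp.sum, Prod.snd_sum, hs]
        exact (Finsupp.sum_single z.2).symm
    rw [h1]
    refine add_mem (Submodule.sum_mem _ fun i _ => Submodule.subset_span ⟨_, _, ?_, rfl⟩)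
      (Submodule.sum_mem _ fun k _ => Submodule.subset_span ⟨_, _, aug_of_mem_S (z.2 k).2, rfl⟩)
    rw [← augMap_apply, h, Finsupp.zero_apply]
  · intro h
    induction h using Submodule.span_induction with
    | mem z hz =>
      obtain ⟨r, m, hr, rfl⟩ := hz
      rw [augMap_smul, hr, zero_smul]
    | zero => rw [map_zero]
    | add a b _ _ ha hb => rw [map_add, ha, hb, add_zero]
    | smul r a _ ha => rw [augMap_smul, ha, smul_zero]

theorem mk_eq_of_equiv {ι κ ι' κ' : Type v}
    (φ : ((ι →₀ Alg K) × (κ →₀ S K)) ≃ₗ[Alg K] (ι' →₀ Alg K) × (κ' →₀ S K)) :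
    #ι = #ι' := by
  let f := (augMap ι' κ').comp (φ.restrictScalars K).toLinearMap
  have hf : Function.Surjective f := (augMap_surjective ι' κ').comp φ.surjective
  have hk : LinearMap.ker (augMap ι κ) = LinearMap.ker f := by
    ext z
    rw [LinearMap.mem_ker, LinearMap.mem_ker, augMap_eq_zero_iff]
    change _ ↔ augMap ι' κ' (φ z) = 0
    rw [augMap_eq_zero_iff]
    refine ⟨map_mem_augPart φ.toLinearMap, fun h => ?_⟩
    simpa using map_mem_augPart φ.symm.toLinearMap h
  let ψ : (ι →₀ K) ≃ₗ[K] (ι' →₀ K) :=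
    (LinearMap.quotKerEquivOfSurjective (M := (ι →₀ Alg K) × (κ →₀ S K)) (augMap ι κ)
      (augMap_surjective ι κ)).symm.trans
      ((Submodule.quotEquivOfEq _ _ hk).trans
        (LinearMap.quotKerEquivOfSurjective (M := (ι →₀ Alg K) × (κ →₀ S K)) f hf))
  exact mk_eq_mk_of_basis' (Finsupp.basisSingleOne.map ψ) Finsupp.basisSingleOne

/-- The source is finitely generated, hence so is its quotient `S^(κ')`, and `S ≠ 0`. -/
theorem finite_of_equiv {ι κ ι' κ' : Type v} [Finite ι] [IsEmpty κ]
    (φ : ((ι →₀ Alg K) × (κ →₀ S K)) ≃ₗ[Alg K] (ι' →₀ Alg K) × (κ' →₀ S K)) :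
    Finite κ' := by
  have h1 : Module.Finite (Alg K) (κ' →₀ S K) :=
    Module.Finite.of_surjective ((LinearMap.snd (Alg K) _ _).comp φ.toLinearMap)
      (Prod.snd_surjective.comp φ.surjective)
  rcases Module.finite_finsupp_iff.1 h1 with h | h | h
  · infer_instance
  · exact absurd (congrArg Subtype.val (Subsingleton.elim (⟨e K, e_mem_S⟩ : S K) 0)) e_ne_zero
  · exact h.2

theorem IsNormalized.eq_of_equiv {α β α' β' : Cardinal.{v}} (h : IsNormalized α β)
    (h' : IsNormalized α' β') (φ : DirectSumRS K α β ≃ₗ[Alg K] DirectSumRS K α' β') :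
    α = α' ∧ β = β' := by
  have hα : α = α' := by simpa using mk_eq_of_equiv φ
  subst hα
  refine ⟨rfl, ?_⟩
  have hβ : α * ℵ₀ + β = α * ℵ₀ + β' := by simpa using mk_mul_aleph0_add_mk_eq φ
  have hfin : ∀ {γ γ' : Cardinal.{v}}, α < ℵ₀ → γ = 0 → ℵ₀ ≤ γ' →
      (DirectSumRS K α γ ≃ₗ[Alg K] DirectSumRS K α γ') → False := by
    intro γ γ' hα hγ hγ' ψ
    have : Finite α.out := lt_aleph0_iff_finite.1 (by rwa [mk_out])
    have : IsEmpty γ.out := mk_eq_zero_iff.1 (by rwa [mk_out])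
    have := finite_of_equiv ψ
    rw [← lt_aleph0_iff_finite, mk_out] at this
    exact this.not_ge hγ'
  rcases eq_or_ne α 0 with rfl | hα0
  · simpa using hβ
  rcases lt_or_ge α ℵ₀ with hα | hα
  · have hmul : α * ℵ₀ = ℵ₀ := mul_eq_right le_rfl hα.le hα0
    rw [hmul] at hβ
    have hn : ∀ {γ}, IsNormalized α γ → γ = 0 ∨ ℵ₀ ≤ γ := by
      rintro γ (h | h | h)
      exacts [h.2, absurd h.1 hα.not_ge, absurd h.1 hα0]
    rcases hn h with h | h <;> rcases hn h' with h' | h'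
    · rw [h, h']
    · exact (hfin hα h h' φ).elim
    · exact (hfin hα h' h φ.symm).elim
    · rwa [add_eq_right h h, add_eq_right h' h'] at hβ
  · rw [mul_aleph0_eq hα] at hβ
    have hn : ∀ {γ}, IsNormalized α γ → γ = 0 ∨ α < γ := by
      rintro γ (h | h | h)
      exacts [absurd h.1 hα.not_gt, h.2, absurd h.1 hα0]
    have hadd : ∀ {γ}, α < γ → α + γ = γ := fun h => add_eq_right (hα.trans h.le) h.le
    rcases hn h with h | h <;> rcases hn h' with h' | h'
    · rw [h, h']
    · rw [h, hadd h', add_zero] at hβ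
      exact absurd hβ h'.ne
    · rw [h', hadd h, add_zero] at hβ
      exact absurd hβ.symm h.ne
    · rwa [hadd h, hadd h'] at hβ

end Invariants

end ToeplitzJacobson

/-! ### The classification -/

theorem corollary2 (K : Type u) [Field K] :
    -- every projective left module is isomorphic to some `R^(α) ⊕ S^(β)`
    (∀ (P : Type v) [AddCommGroup P] [Module (ToeplitzJacobson.Alg K) P]
        [Module.Projective (ToeplitzJacobson.Alg K) P],
      ∃ α β : Cardinal.{v},
        Nonempty (P ≃ₗ[ToeplitzJacobson.Alg K] ToeplitzJacobson.DirectSumRS K α β)) ∧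
    -- the pair can be chosen normalized, and the normalized pair is unique
    (∀ (P : Type v) [AddCommGroup P] [Module (ToeplitzJacobson.Alg K) P]
        [Module.Projective (ToeplitzJacobson.Alg K) P],
      ∃! p : Cardinal.{v} × Cardinal.{v},
        ToeplitzJacobson.IsNormalized p.1 p.2 ∧
        Nonempty (P ≃ₗ[ToeplitzJacobson.Alg K] ToeplitzJacobson.DirectSumRS K p.1 p.2)) ∧
    -- every `R^(α) ⊕ S^(β)` is projective
    (∀ α β : Cardinal.{v},
      Module.Projective (ToeplitzJacobson.Alg K) (ToeplitzJacobson.DirectSumRS K α β)) ∧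
    -- distinct normalized pairs give non-isomorphic modules
    (∀ α β α' β' : Cardinal.{v},
      ToeplitzJacobson.IsNormalized α β → ToeplitzJacobson.IsNormalized α' β' →
      Nonempty (ToeplitzJacobson.DirectSumRS K α β ≃ₗ[ToeplitzJacobson.Alg K]
        ToeplitzJacobson.DirectSumRS K α' β') →
      α = α' ∧ β = β') := by
  refine ⟨fun P _ _ _ => ?_, fun P _ _ _ => ?_, fun α β => ?_, fun α β α' β' h h' ⟨φ⟩ =>
    h.eq_of_equiv h' φ⟩
  · obtain ⟨ι, κ, ⟨f⟩⟩ := ToeplitzJacobson.exists_equiv_prod (K := K) (P := P)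
    obtain ⟨α, β, -, ⟨g⟩⟩ := ToeplitzJacobson.exists_isNormalized (K := K) ι κ
    exact ⟨α, β, ⟨f.trans g⟩⟩
  · obtain ⟨ι, κ, ⟨f⟩⟩ := ToeplitzJacobson.exists_equiv_prod (K := K) (P := P)
    obtain ⟨α, β, h, ⟨g⟩⟩ := ToeplitzJacobson.exists_isNormalized (K := K) ι κ
    refine ⟨(α, β), ⟨h, ⟨f.trans g⟩⟩, ?_⟩
    rintro ⟨α', β'⟩ ⟨h', ⟨g'⟩⟩
    obtain ⟨hα, hβ⟩ := h'.eq_of_equiv h (g'.symm.trans (f.trans g))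
    exact Prod.ext hα hβ
  · have : Module.Projective (ToeplitzJacobson.Alg K)
        (Quotient.out β →₀ ToeplitzJacobson.S K) := ToeplitzJacobson.projective_finsupp
    infer_instance
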